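/- Let $T_n = C_n \square C_n$ be the toroidal grid with vertex set $\mathbb{Z}_n \times \mathbb{Z}_n$ and let $M = \lfloor n/4 \rfloor$. A strategy $\mathcal{S}$ of the survivor consists of a starting vertex and of a sequence of $M$ moves (West, East, North, South or stay put), both fixed in advance; let $(a,b)$ be the vertex at which he finishes. The game lasts $M$ rounds. In each round the survivor makes his next move, and the zombie moves to a neighbour of her current vertex that is strictly closer in $T_n$ to the current vertex of the survivor, chosen uniformly at random among all such neighbours. The zombie eats the survivor if at some time they are at the same vertex. For $x,y \in \mathbb{Z}$ let $p_{\mathcal{S}}(x,y)$ be the probability that a zombie starting at $(a+x,b+y)$ eats the survivor who uses $\mathcal{S}$, and put $$t(\mathcal{S}) = \sum_{x=-M}^{M}\sum_{y=-M}^{M} p_{\mathcal{S}}(x,y), \qquad t_n = \min_{\mathcal{S}} t(\mathcal{S}),$$ where the minimum is over all $n^2 5^M$ strategies. Let $\mathcal{S}_d$ be the strategy that starts at $(\lfloor M/2\rfloor, \lceil M/2\rceil)$ and goes along the diagonal to $(0,0)$ by the moves South, West, South, West, and so on ($M$ moves in all). Theorem. As $n \to \infty$, $t(\mathcal{S}_d)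 = O(n^{3/2})$. Consequently $t_n = O(n^{3/2})$, and $t_n > 0$ for all large $n$ and $n^{3/2} = O(n^3/t_n)$; that is, the upper bound $z(T_n) = O(n^3/t_n)$ on the zombie number of $T_n$ cannot give anything better than $O(n^{3/2})$. All of this holds for each of the two orders of play: the zombie moves first in every round, or the survivor moves first in every round. -/

import Mathlib

open Filter Asymptotics

namespace ZombieTorus

/-- The vertex set `ℤ_n × ℤ_n` of the toroidal grid `T_n`. -/
abbrev Vertex (n : ℕ) : Type := ZMod n × ZMod n

/-- The cycle `C_n` on the vertex set `ℤ_n` (`a` and `a + 1` are joined). -/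
def cycle (n : ℕ) : SimpleGraph (ZMod n) := SimpleGraph.circulantGraph {1}

/-- The toroidal grid `T_n`, the Cartesian product of two copies of `C_n`. -/
def torus (n : ℕ) : SimpleGraph (Vertex n) := (cycle n).boxProd (cycle n)

/-- The neighbours of `z` in `T_n` that are strictly closer to `s` than `z` is, that is, the
second vertices of the shortest paths from `z` to `s`. -/
def closer (n : ℕ) (s z : Vertex n) : Set (Vertex n) :=
  {w | (torus n).Adj z w ∧ (torus n).dist w s < (torus n).dist z s}

open Classical in
/-- The random move of a zombie at `z` when the survivor is at `s`: a uniformly random neighbour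
of `z` that is closer to `s`. If there is none (that is, if `z = s`), she stays. -/
noncomputable def zombieStep (n : ℕ) (s z : Vertex n) : PMF (Vertex n) :=
  if h : (closer n s z).Finite ∧ (closer n s z).Nonempty then
    PMF.uniformOfFinset h.1.toFinset (h.1.toFinset_nonempty.mpr h.2)
  else PMF.pure z

/-- The options of the survivor in each round. -/
inductive Move
  | west | east | north | south | stay

/-- The displacement of the survivor caused by a move. -/
def Move.vec (n : ℕ) : Move → Vertex n
  | .west => (-1, 0)
  | .east => (1, 0)
  | .north => (0, 1)
  | .south => (0, -1)
  | .stay => (0, 0)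

/-- The number `M = ⌊n/4⌋` of rounds. -/
def rounds (n : ℕ) : ℕ := n / 4

/-- The family `𝓕`: a starting vertex and a sequence of `M` moves, both fixed in advance. -/
structure Strategy (n : ℕ) where
  start : Vertex n
  move : Fin (rounds n) → Move

/-- The vertex at which the survivor finishes his walk. -/
def Strategy.final {n : ℕ} (S : Strategy n) : Vertex n := S.start + ∑ i, (S.move i).vec n

/-- Who moves first in a round. With `zombies`, the zombie's `i`-th move is directed at the
position of the survivor after `i - 1` of his moves; with `survivor`, at the one after `i` of
his moves (so that her last move is directed at his final position). -/
inductive MovesFirst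
  | zombies | survivor

open Classical in
/-- The outcome (`true` if the survivor is eaten) of the game of one zombie at `z` against the
survivor at `s` who is going to make the given moves, one in each round. The survivor is eaten
as soon as he and the zombie are at the same vertex. -/
noncomputable def play (τ : MovesFirst) (n : ℕ) : List Move → Vertex n → Vertex n → PMF Bool
  | [], s, z => PMF.pure (decide (z = s))
  | m :: l, s, z =>
    if z = s then PMF.pure true
    else match τ with
      | .zombies => (zombieStep n s z).bind fun w =>
          if w = s then PMF.pure true else play τ n l (s + m.vec n) w
      | .survivor => (zombieStep n (s + m.vec n) z).bind fun w => play τ n l (s + m.vec n) w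

/-- `p_S(x, y)`: the probability that a zombie starting at `(a + x, b + y)` eats the survivor who
uses the strategy `S`, where `(a, b)` is the vertex at which `S` finishes. -/
noncomputable def eatProb (τ : MovesFirst) {n : ℕ} (S : Strategy n) (x y : ℤ) : ℝ :=
  (play τ n (List.ofFn S.move) S.start (S.final + ((x : ZMod n), (y : ZMod n))) true).toReal

/-- The total weight `t(S)`, the sum of `p_S(x, y)` over `-M ≤ x, y ≤ M`. -/
noncomputable def weight (τ : MovesFirst) {n : ℕ} (S : Strategy n) : ℝ :=
  ∑ x ∈ Finset.Icc (-(rounds n : ℤ)) (rounds n),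
    ∑ y ∈ Finset.Icc (-(rounds n : ℤ)) (rounds n), eatProb τ S x y

/-- `t_n`, the minimum of `t(S)` over the strategies `S` (a finite family if `n ≥ 1`). -/
noncomputable def minWeight (τ : MovesFirst) (n : ℕ) : ℝ := ⨅ S : Strategy n, weight τ S

/-- Strategy (d): start at `(⌊M/2⌋, ⌈M/2⌉)` and go along the diagonal, South, West, South, … -/
def diagonal (n : ℕ) : Strategy n where
  start := (((rounds n / 2 : ℕ) : ZMod n), (((rounds n + 1) / 2 : ℕ) : ZMod n))
  move i := if (i : ℕ) % 2 = 0 then .south else .west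

end ZombieTorus

namespace ZombieTorus

/-! ### Distances in the torus and the moves of the zombie -/

/-! Let D be the position of the zombie relative to the survivor. Within distance n/2 the torus
looks like ℤ², so the game becomes a walk on ℤ²: the zombie steps towards the origin, while the
survivor's South and West moves add (0, 1) and (1, 0) in turn (`play_diagonalMoves`). Summing the
eating probabilities over all starting points of ℤ² gives the mass absorbed at the origin when the
initial density is 1 everywhere. By duality (`tsum_mul_hit_le`) this is at most the sum over time of
the value at 0 of any density that dominates the evolution.

Such a density is explicit. Zombies with both coordinates nonnegative are harmless unless next to
the survivor (`hit_eq_zero`). Where y < 0 the density depends on x alone. It stays 1 for x < 0. For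
x > 0, a period of four half-steps contains two zombie moves with mean -1/2 each in x and one shift
by +1, so x performs a driftless lazy walk. Mass entering from x < 0 therefore accumulates near the
axis as in the heat equation on a half-line with constant influx: about √t after time t. A quadratic
supersolution proves this bound (`profile_shift`), and the other axis is the same with a delay of
two half-steps. Adding O(√n) over O(n) half-steps gives O(n^(3/2)) (`weight_diagonal_le`).

For positivity, every strategy has weight at least 1, because a zombie placed on the survivor's
starting vertex, which lies in the window, eats him at once. -/

lemma cycle_adj_add_one {n : ℕ} (hn : 2 ≤ n) (a : ZMod n) : (cycle n).Adj a (a + 1) := by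
  have : Fact (1 < n) := ⟨hn⟩
  simp [cycle]

lemma cycle_adj_iff {n : ℕ} (hn : 2 ≤ n) (a b : ZMod n) :
    (cycle n).Adj a b ↔ b = a + 1 ∨ b = a - 1 := by
  constructor
  · intro h
    simp only [cycle, SimpleGraph.circulantGraph_adj, Set.mem_singleton_iff] at h
    rcases h.2 with h | h
    · right; rw [← h]; ring
    · left; rw [← h]; ring
  · rintro (rfl | rfl)
    · exact cycle_adj_add_one hn a
    · simpa using (cycle_adj_add_one hn (a - 1)).symm

lemma cycle_edist_add_natCast_le {n : ℕ} (hn : 2 ≤ n) (a : ZMod n) (k : ℕ) :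
    (cycle n).edist a (a + k) ≤ k := by
  induction k with
  | zero => simp
  | succ k ih =>
    calc (cycle n).edist a (a + (k + 1 : ℕ))
        ≤ (cycle n).edist a (a + k) + (cycle n).edist (a + k) (a + (k + 1 : ℕ)) :=
          SimpleGraph.edist_triangle
      _ ≤ k + 1 := by
          gcongr
          have := cycle_adj_add_one hn (a + k)
          rw [← SimpleGraph.edist_eq_one_iff_adj] at this
          rw [Nat.cast_succ, ← add_assoc, this]
      _ = _ := by push_cast; rfl

/-- The least absolute residue is subadditive, and an edge changes the difference by ±1, of least
absolute residue at most 1. -/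
lemma natAbs_valMinAbs_le_length {n : ℕ} (hn : 2 ≤ n) {a b : ZMod n} (w : (cycle n).Walk a b) :
    (b - a).valMinAbs.natAbs ≤ w.length := by
  induction w with
  | nil => simp
  | @cons a c b h w ih =>
    have hone : (c - a).valMinAbs.natAbs ≤ 1 := by
      have : (1 : ZMod n).valMinAbs.natAbs ≤ 1 := by
        have : NeZero n := ⟨by omega⟩
        have h : (1 : ZMod n).valMinAbs = 1 := by
          rw [ZMod.valMinAbs_spec]
          exact ⟨by simp, by omega, by omega⟩
        simp [h]
      rcases (cycle_adj_iff hn a c).1 h with rfl | rfl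
      · simpa using this
      · simpa [sub_sub_cancel_left] using this
    have := ZMod.natAbs_valMinAbs_add_le (c - a) (b - c)
    rw [sub_add_sub_cancel'] at this
    have h2 := Int.natAbs_add_le (c - a).valMinAbs (b - c).valMinAbs
    simp only [SimpleGraph.Walk.length_cons]
    omega

lemma cycle_edist_add_intCast {n : ℕ} (hn : 2 ≤ n) (a : ZMod n) {x : ℤ} (h₁ : 2 * |x| < n) :
    (cycle n).edist a (a + x) = x.natAbs := by
  apply le_antisymm
  · rcases Int.natAbs_eq x with hx | hx
    · have := cycle_edist_add_natCast_le hn a x.natAbs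
      rwa [← Int.cast_natCast, ← hx] at this
    -- For negative x, walk forwards from a + x to a.
    · have := cycle_edist_add_natCast_le hn (a + x) x.natAbs
      rw [SimpleGraph.edist_comm] at this
      rwa [← Int.cast_natCast (R := ZMod n), add_assoc, ← Int.cast_add,
        show x + (x.natAbs : ℤ) = 0 by omega, Int.cast_zero, add_zero] at this
  · by_contra! hlt
    obtain ⟨w, hw⟩ := SimpleGraph.exists_walk_of_edist_ne_top (hlt.ne_top)
    have h := natAbs_valMinAbs_le_length hn w
    have hv : ((x : ℤ) : ZMod n).valMinAbs = x := by
      have : NeZero n := ⟨by omega⟩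
      rw [ZMod.valMinAbs_spec]
      refine ⟨rfl, ?_, ?_⟩ <;> have := abs_lt.1 (show |x| < |x| + 1 by omega) <;>
        rcases abs_cases x with h | h <;> omega
    rw [add_sub_cancel_left, hv] at h
    rw [← hw] at hlt
    exact absurd (Nat.cast_lt.1 hlt) (by omega)

/-- The reduction `ℤ × ℤ → ℤ_n × ℤ_n`. -/
def red (n : ℕ) (D : ℤ × ℤ) : Vertex n := ((D.1 : ZMod n), (D.2 : ZMod n))

lemma red_add (n : ℕ) (D E : ℤ × ℤ) : red n (D + E) = red n D + red n E := by
  simp [red]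

@[simp] lemma red_zero (n : ℕ) : red n 0 = 0 := by simp [red]

lemma torus_dist_add_red {n : ℕ} (hn : 2 ≤ n) (s : Vertex n) {D : ℤ × ℤ} (h₁ : 2 * |D.1| < n)
    (h₂ : 2 * |D.2| < n) : (torus n).dist (s + red n D) s = D.1.natAbs + D.2.natAbs := by
  rw [SimpleGraph.dist_comm, SimpleGraph.dist, torus, SimpleGraph.edist_boxProd]
  simp only [red, Prod.fst_add, Prod.snd_add]
  rw [cycle_edist_add_intCast hn _ h₁, cycle_edist_add_intCast hn _ h₂]
  rfl

lemma red_injOn {n : ℕ} {D E : ℤ × ℤ} (hD₁ : 2 * |D.1| < n) (hD₂ : 2 * |D.2| < n)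
    (hE₁ : 2 * |E.1| < n) (hE₂ : 2 * |E.2| < n) : red n D = red n E ↔ D = E := by
  constructor
  · intro h
    have key : ∀ a b : ℤ, 2 * |a| < n → 2 * |b| < n → (a : ZMod n) = b → a = b := by
      intro a b ha hb hab
      rw [ZMod.intCast_eq_intCast_iff_dvd_sub] at hab
      have : |b - a| < n := by
        have := abs_sub b a
        omega
      have := Int.eq_zero_of_abs_lt_dvd hab this
      omega
    simp only [red, Prod.mk.injEq] at h
    exact Prod.ext (key _ _ hD₁ hE₁ h.1) (key _ _ hD₂ hE₂ h.2)
  · rintro rfl; rfl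

/-- The four unit vectors. -/
def dirs : Finset (ℤ × ℤ) := {(1, 0), (-1, 0), (0, 1), (0, -1)}

lemma exists_dirs (p : ℤ × ℤ → Prop) :
    (∃ v ∈ dirs, p v) ↔ p (1, 0) ∨ p (-1, 0) ∨ p (0, 1) ∨ p (0, -1) := by
  simp [dirs]

lemma torus_adj_iff {n : ℕ} (hn : 2 ≤ n) (z w : Vertex n) :
    (torus n).Adj z w ↔ ∃ v ∈ dirs, w = z + red n v := by
  obtain ⟨z₁, z₂⟩ := z
  obtain ⟨w₁, w₂⟩ := w
  simp only [torus, SimpleGraph.boxProd_adj, cycle_adj_iff hn, exists_dirs, red]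
  simp only [Prod.ext_iff, Prod.fst_add, Prod.snd_add, Int.cast_zero, Int.cast_one, Int.cast_neg,
    add_zero, ← sub_eq_add_neg]
  tauto

/-- The probability that a zombie whose position relative to the survivor is `D` makes the
move `v`. -/
noncomputable def stepProb (v D : ℤ × ℤ) : ℝ :=
  if v.1 * D.1 + v.2 * D.2 < 0 then (if D.1 = 0 ∨ D.2 = 0 then 1 else 1 / 2) else 0

/-- The slack +1 keeps the neighbours of D below n/2 too, so distances before and after the move are
ℓ¹ norms. A unit step v lowers the ℓ¹ norm exactly when its inner product with D is negative. -/
lemma mem_closer_iff {n : ℕ} (s : Vertex n) {D : ℤ × ℤ} (h₁ : 2 * (|D.1| + 1) < n)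
    (h₂ : 2 * (|D.2| + 1) < n) (w : Vertex n) :
    w ∈ closer n s (s + red n D) ↔
      ∃ v ∈ dirs, v.1 * D.1 + v.2 * D.2 < 0 ∧ w = s + red n (D + v) := by
  have hn : 2 ≤ n := by have := abs_nonneg D.1; omega
  have key : ∀ v ∈ dirs, ((torus n).dist (s + red n D + red n v) s <
      (torus n).dist (s + red n D) s ↔ v.1 * D.1 + v.2 * D.2 < 0) := by
    intro v hv
    rw [add_assoc, ← red_add, torus_dist_add_red hn s (D := D) (by omega) (by omega)]
    simp only [dirs, Finset.mem_insert, Finset.mem_singleton] at hv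
    rcases hv with rfl | rfl | rfl | rfl <;> rw [torus_dist_add_red hn s] <;>
      simp only [Prod.fst_add, Prod.snd_add] <;> grind
  simp only [closer, Set.mem_ofPred_eq, torus_adj_iff hn]
  constructor
  · rintro ⟨⟨v, hv, rfl⟩, h⟩
    exact ⟨v, hv, (key v hv).1 h, by rw [red_add, add_assoc]⟩
  · rintro ⟨v, hv, h, rfl⟩
    rw [red_add, ← add_assoc]
    exact ⟨⟨v, hv, rfl⟩, (key v hv).2 h⟩

lemma zombieStep_bind_of_singleton {n : ℕ} {s z w : Vertex n} (h : closer n s z = {w})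
    (F : Vertex n → PMF Bool) : (zombieStep n s z).bind F = F w := by
  have : zombieStep n s z = PMF.pure w := by
    rw [zombieStep, dif_pos (by simp [h])]
    ext a
    simp [h, PMF.uniformOfFinset_apply, PMF.pure_apply]
  rw [this, PMF.pure_bind]

lemma zombieStep_bind_of_pair {n : ℕ} {s z w₁ w₂ : Vertex n} (h : closer n s z = {w₁, w₂})
    (hne : w₁ ≠ w₂) (F : Vertex n → PMF Bool) (b : Bool) :
    (zombieStep n s z).bind F b = 2⁻¹ * F w₁ b + 2⁻¹ * F w₂ b := by
  classical
  rw [zombieStep, dif_pos (by simp [h]), PMF.bind_apply]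
  have hf : ∀ hh : (closer n s z).Finite, hh.toFinset = {w₁, w₂} := by
    intro hh; ext a; simp [h]
  rw [tsum_eq_sum (s := {w₁, w₂})]
  · rw [Finset.sum_pair hne]
    simp [PMF.uniformOfFinset_apply, hf, Finset.card_pair hne]
  · intro a ha
    rw [PMF.uniformOfFinset_apply_of_notMem]
    · simp
    · rwa [hf]

/-- The average of `h` over the random move of the zombie, in relative coordinates. -/
noncomputable def zombieAvg (h : ℤ × ℤ → ENNReal) (D : ℤ × ℤ) : ENNReal :=
  ∑ v ∈ dirs, ENNReal.ofReal (stepProb v D) * h (D + v)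

lemma sum_dirs {α : Type*} [AddCommMonoid α] (f : ℤ × ℤ → α) :
    ∑ v ∈ dirs, f v = f (1, 0) + (f (-1, 0) + (f (0, 1) + f (0, -1))) := by
  rw [dirs, Finset.sum_insert (by decide), Finset.sum_insert (by decide),
    Finset.sum_insert (by decide), Finset.sum_singleton]

/-- One case for each pair of signs: on an axis a single move is closer, elsewhere two are. The two
targets remain distinct modulo n, so each has probability 1/2. -/
lemma zombieStep_bind_apply {n : ℕ} (s : Vertex n) {D : ℤ × ℤ} (h₁ : 2 * (|D.1| + 1) < n)
    (h₂ : 2 * (|D.2| + 1) < n) (hD : D ≠ 0) (F : Vertex n → PMF Bool) :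
    (zombieStep n s (s + red n D)).bind F true =
      zombieAvg (fun E => F (s + red n E) true) D := by
  obtain ⟨x, y⟩ := D
  have hhalf : ENNReal.ofReal 2⁻¹ = 2⁻¹ := by
    rw [ENNReal.ofReal_inv_of_pos (by norm_num)]; simp
  have hc : ∀ w, _ := mem_closer_iff s h₁ h₂
  simp only [exists_dirs] at hc
  have hne : ∀ v ∈ dirs, ∀ v' ∈ dirs, v ≠ v' →
      s + red n ((x, y) + v) ≠ s + red n ((x, y) + v') := by
    intro v hv v' hv' hvv h
    simp only [dirs, Finset.mem_insert, Finset.mem_singleton] at hv hv'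
    rw [add_right_inj, red_injOn] at h
    · exact hvv (add_left_cancel h)
    all_goals
      rcases hv with rfl | rfl | rfl | rfl <;> simp only [Prod.fst_add, Prod.snd_add] <;> grind
  simp only [Prod.mk_add_mk] at *
  rcases lt_trichotomy x 0 with hx | rfl | hx <;> rcases lt_trichotomy y 0 with hy | rfl | hy
  · rw [zombieStep_bind_of_pair (w₁ := s + red n ((x, y) + (1, 0))) (w₂ := s + red n ((x, y) + (0, 1)))
      (by ext w; rw [hc]; simp [*, not_lt_of_gt])
      (hne _ (by simp [dirs]) _ (by simp [dirs]) (by simp))]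
    simp [*, zombieAvg, sum_dirs, stepProb, not_lt_of_gt, ne_of_lt]
  · rw [zombieStep_bind_of_singleton (w := s + red n ((x, 0) + (1, 0)))
      (by ext w; rw [hc]; simp [*, not_lt_of_gt])]
    simp [*, zombieAvg, sum_dirs, stepProb, not_lt_of_gt]
  · rw [zombieStep_bind_of_pair (w₁ := s + red n ((x, y) + (1, 0))) (w₂ := s + red n ((x, y) + (0, -1)))
      (by ext w; rw [hc]; simp [*, not_lt_of_gt])
      (hne _ (by simp [dirs]) _ (by simp [dirs]) (by simp))]
    simp [*, zombieAvg, sum_dirs, stepProb, not_lt_of_gt, ne_of_lt, ne_of_gt]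
  · rw [zombieStep_bind_of_singleton (w := s + red n ((0, y) + (0, 1)))
      (by ext w; rw [hc]; simp [*, not_lt_of_gt])]
    simp [*, zombieAvg, sum_dirs, stepProb, not_lt_of_gt]
  · exact absurd rfl hD
  · rw [zombieStep_bind_of_singleton (w := s + red n ((0, y) + (0, -1)))
      (by ext w; rw [hc]; simp [*, not_lt_of_gt])]
    simp [*, zombieAvg, sum_dirs, stepProb, not_lt_of_gt]
  · rw [zombieStep_bind_of_pair (w₁ := s + red n ((x, y) + (-1, 0))) (w₂ := s + red n ((x, y) + (0, 1)))
      (by ext w; rw [hc]; simp [*, not_lt_of_gt])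
      (hne _ (by simp [dirs]) _ (by simp [dirs]) (by simp))]
    simp [*, zombieAvg, sum_dirs, stepProb, not_lt_of_gt, ne_of_lt, ne_of_gt]
  · rw [zombieStep_bind_of_singleton (w := s + red n ((x, 0) + (-1, 0)))
      (by ext w; rw [hc]; simp [*, not_lt_of_gt])]
    simp [*, zombieAvg, sum_dirs, stepProb, not_lt_of_gt]
  · rw [zombieStep_bind_of_pair (w₁ := s + red n ((x, y) + (-1, 0))) (w₂ := s + red n ((x, y) + (0, -1)))
      (by ext w; rw [hc]; simp [*, not_lt_of_gt])
      (hne _ (by simp [dirs]) _ (by simp [dirs]) (by simp))]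
    simp [*, zombieAvg, sum_dirs, stepProb, not_lt_of_gt, ne_of_gt]

/-! ### The game in relative coordinates -/

/-- The displacement, relative to the survivor, caused by his move at the (odd) half-step `k`. -/
def shift (k : ℕ) : ℤ × ℤ := if k % 4 = 1 then (0, 1) else (1, 0)

/-- The probability that a zombie whose position relative to the survivor is `D` eats him within
`r` half-steps, the first of which has number `k`. The zombie moves at even half-steps, the
survivor goes South at the half-steps `1 mod 4` and West at the half-steps `3 mod 4`. -/
noncomputable def hit : ℕ → ℕ → ℤ × ℤ → ENNReal
  | 0, _, D => if D = 0 then 1 else 0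
  | r + 1, k, D => if D = 0 then 1 else
      if k % 2 = 0 then zombieAvg (hit r (k + 1)) D else hit r (k + 1) (D + shift k)

lemma hit_zero_right (r k : ℕ) : hit r k 0 = 1 := by
  cases r <;> simp [hit]

/-- A zombie behind the survivor in both coordinates never gets closer to him. -/
lemma hit_eq_zero (r : ℕ) : ∀ (k : ℕ) (D : ℤ × ℤ), 0 ≤ D.1 → 0 ≤ D.2 →
    2 ≤ D.1 + D.2 + (k % 2 : ℕ) → hit r k D = 0 := by
  induction r with
  | zero =>
    intro k D h₁ h₂ h
    have : D ≠ 0 := by rintro rfl; simp at h; omega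
    simp [hit, this]
  | succ r ih =>
    intro k D h₁ h₂ h
    have hD : D ≠ 0 := by rintro rfl; simp at h; omega
    rw [hit, if_neg hD]
    split_ifs with hk
    · refine Finset.sum_eq_zero fun v hv => ?_
      by_cases hneg : v.1 * D.1 + v.2 * D.2 < 0
      · rw [ih, mul_zero]
        all_goals
          simp only [dirs, Finset.mem_insert, Finset.mem_singleton] at hv
          rcases hv with rfl | rfl | rfl | rfl <;> simp only [Prod.fst_add, Prod.snd_add] <;>
            simp only at hneg <;> omega
      · simp [stepProb, hneg]
    · apply ih <;> rw [shift] <;> split_ifs <;> simp only [Prod.fst_add, Prod.snd_add] <;> omega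

/-- The density after the half-step `k` of zombies distributed with the density `g` before. -/
noncomputable def push (k : ℕ) (g : ℤ × ℤ → ℝ) (D : ℤ × ℤ) : ℝ :=
  if k % 2 = 0 then ∑ v ∈ dirs, stepProb v (D - v) * g (D - v)
  else if D = shift k then 0 else g (D - shift k)

lemma stepProb_nonneg (v D : ℤ × ℤ) : 0 ≤ stepProb v D := by
  rw [stepProb]; split_ifs <;> norm_num

/-- Averaging a test function is adjoint to transporting a density; reindex by D ↦ D + v. -/
lemma tsum_mul_zombieAvg {g : ℤ × ℤ → ℝ} (hg : ∀ D, 0 ≤ g D) (h : ℤ × ℤ → ENNReal) :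
    ∑' D, ENNReal.ofReal (g D) * zombieAvg h D =
      ∑' D, ENNReal.ofReal (∑ v ∈ dirs, stepProb v (D - v) * g (D - v)) * h D := by
  have h₁ : ∀ D, ENNReal.ofReal (g D) * zombieAvg h D =
      ∑ v ∈ dirs, ENNReal.ofReal (stepProb v D * g D) * h (D + v) := fun D => by
    rw [zombieAvg, Finset.mul_sum]
    refine Finset.sum_congr rfl fun v _ => ?_
    rw [ENNReal.ofReal_mul (stepProb_nonneg v D)]
    ring
  have h₂ : ∀ D, ENNReal.ofReal (∑ v ∈ dirs, stepProb v (D - v) * g (D - v)) * h D =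
      ∑ v ∈ dirs, ENNReal.ofReal (stepProb v (D - v) * g (D - v)) * h D := fun D => by
    rw [ENNReal.ofReal_sum_of_nonneg fun v _ => mul_nonneg (stepProb_nonneg _ _) (hg _),
      Finset.sum_mul]
  simp only [h₁, h₂]
  rw [Summable.tsum_finsetSum fun _ _ => ENNReal.summable,
    Summable.tsum_finsetSum fun _ _ => ENNReal.summable]
  refine Finset.sum_congr rfl fun v _ => ?_
  rw [← (Equiv.addRight v).tsum_eq
    (fun D => ENNReal.ofReal (stepProb v (D - v) * g (D - v)) * h D)]
  simp

/-- Mass at the origin is absorbed and counted as `g 0`; the rest is transported. Domination by `g'`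
is needed only where `hit` can be nonzero, which is why the quarter plane behind the survivor is
exempt. -/
lemma tsum_mul_hit_succ_le {k r : ℕ} {g g' : ℤ × ℤ → ℝ} (hg : ∀ D, 0 ≤ g D)
    (H : ∀ D : ℤ × ℤ, ¬ (0 ≤ D.1 ∧ 0 ≤ D.2 ∧ 2 ≤ D.1 + D.2 + ((k + 1) % 2 : ℕ)) →
      push k g D ≤ g' D) :
    ∑' D, ENNReal.ofReal (g D) * hit (r + 1) k D ≤
      ENNReal.ofReal (g 0) + ∑' D, ENNReal.ofReal (g' D) * hit r (k + 1) D := by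
  have h₁ : ∀ D, ENNReal.ofReal (g D) * hit (r + 1) k D ≤
      (if D = 0 then ENNReal.ofReal (g 0) else 0) +
        ENNReal.ofReal (g D) * (if k % 2 = 0 then zombieAvg (hit r (k + 1)) D
          else if D = 0 then 0 else hit r (k + 1) (D + shift k)) := by
    intro D
    rw [hit]
    by_cases hD : D = 0
    · subst hD; simp
    · simp [hD]
  refine (ENNReal.tsum_le_tsum h₁).trans ?_
  rw [ENNReal.tsum_add, tsum_ite_eq]
  refine add_le_add_right ?_ _
  have h₂ : ∑' D, ENNReal.ofReal (g D) * (if k % 2 = 0 then zombieAvg (hit r (k + 1)) D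
      else if D = 0 then 0 else hit r (k + 1) (D + shift k)) =
      ∑' D, ENNReal.ofReal (push k g D) * hit r (k + 1) D := by
    by_cases hk : k % 2 = 0
    · simp only [hk, if_true, push]
      exact tsum_mul_zombieAvg hg _
    · simp only [hk, if_false, push]
      rw [← (Equiv.addRight (shift k)).tsum_eq
        (fun D => ENNReal.ofReal (if D = shift k then 0 else g (D - shift k)) * hit r (k + 1) D)]
      refine tsum_congr fun D => ?_
      by_cases hD : D = 0 <;> simp [hD]
  rw [h₂]
  refine ENNReal.tsum_le_tsum fun D => ?_
  by_cases hD : 0 ≤ D.1 ∧ 0 ≤ D.2 ∧ 2 ≤ D.1 + D.2 + ((k + 1) % 2 : ℕ)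
  · rw [hit_eq_zero r (k + 1) D hD.1 hD.2.1 hD.2.2]; simp
  · gcongr
    exact H D hD

lemma tsum_mul_hit_le {g : ℕ → ℤ × ℤ → ℝ} (hg : ∀ k D, 0 ≤ g k D)
    (H : ∀ (k : ℕ) (D : ℤ × ℤ), ¬ (0 ≤ D.1 ∧ 0 ≤ D.2 ∧ 2 ≤ D.1 + D.2 + ((k + 1) % 2 : ℕ)) →
      push k (g k) D ≤ g (k + 1) D) (r k : ℕ) :
    ∑' D, ENNReal.ofReal (g k D) * hit r k D ≤
      ∑ j ∈ Finset.range (r + 1), ENNReal.ofReal (g (k + j) 0) := by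
  induction r generalizing k with
  | zero =>
    rw [tsum_eq_single 0 fun D hD => by simp [hit, hD]]
    simp [hit]
  | succ r ih =>
    refine (tsum_mul_hit_succ_le (hg k) (H k)).trans ?_
    rw [Finset.sum_range_succ', add_comm]
    refine add_le_add ?_ le_rfl
    simpa [add_assoc, add_comm, add_left_comm] using ih (k + 1)

/-! ### A supersolution for the density of the zombies -/

/-- A supersolution of the discrete heat equation on the half-line with unit influx at `0`. -/
noncomputable def bulk (κ L : ℝ) (t : ℕ) (x : ℤ) : ℝ := 1 + κ * (t / 2 + (L - x) ^ 2)

/-- The profile of the density of the zombies across an axis, before the half-step `k`. -/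
noncomputable def profile (κ L : ℝ) (k : ℕ) (x : ℤ) : ℝ :=
  if x < 0 then 1
  else if k % 4 = 0 then (if x = 0 then 1 else bulk κ L (k / 4) x)
  else if k % 4 = 3 then
    (if x = 0 then 2 + 3 / 4 * bulk κ L (k / 4) 1 + 1 / 4 * bulk κ L (k / 4) 2
     else 1 / 4 * bulk κ L (k / 4) x + 1 / 2 * bulk κ L (k / 4) (x + 1)
      + 1 / 4 * bulk κ L (k / 4) (x + 2))
  else (if x = 0 then 3 / 2 + 1 / 2 * bulk κ L (k / 4) 1
    else 1 / 2 * bulk κ L (k / 4) x + 1 / 2 * bulk κ L (k / 4) (x + 1))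

/-- An upper bound for the profile near the axis. -/
noncomputable def peak (κ L : ℝ) (k : ℕ) : ℝ := 3 + κ * ((k + 2) / 8 + L ^ 2)

section

variable {κ L : ℝ}

lemma one_le_bulk (hκ : 0 ≤ κ) (t : ℕ) (x : ℤ) : 1 ≤ bulk κ L t x := by
  rw [bulk]; have : 0 ≤ κ * (t / 2 + (L - x) ^ 2) := by positivity
  linarith

lemma bulk_le_peak (hκ : 0 ≤ κ) {k t : ℕ} (ht : 4 * t ≤ k + 2) {x : ℤ} (hx : 0 ≤ x)
    (hxL : x ≤ 2 * L) : bulk κ L t x ≤ peak κ L k - 2 := by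
  have hx' : (0 : ℝ) ≤ x := by exact_mod_cast hx
  have ht' : (4 : ℝ) * t ≤ k + 2 := by exact_mod_cast ht
  have : (L - x) ^ 2 ≤ L ^ 2 := by nlinarith
  have : κ * (t / 2 + (L - x) ^ 2) ≤ κ * ((k + 2) / 8 + L ^ 2) := by
    refine mul_le_mul_of_nonneg_left ?_ hκ
    linarith
  rw [bulk, peak]; linarith

lemma peak_mono (hκ : 0 ≤ κ) {k l : ℕ} (h : k ≤ l) : peak κ L k ≤ peak κ L l := by
  rw [peak, peak]; gcongr

lemma three_le_peak (hκ : 0 ≤ κ) (k : ℕ) : 3 ≤ peak κ L k := by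
  rw [peak]; have : 0 ≤ κ * ((k + 2) / 8 + L ^ 2) := by positivity
  linarith

lemma profile_of_neg (k : ℕ) {x : ℤ} (hx : x < 0) : profile κ L k x = 1 := by
  simp [profile, hx]

lemma one_le_profile (hκ : 0 ≤ κ) (k : ℕ) (x : ℤ) : 1 ≤ profile κ L k x := by
  have h := one_le_bulk (L := L) hκ (k / 4)
  rw [profile]
  split_ifs <;> linarith [h x, h (x + 1), h (x + 2), h 1, h 2]

/-- For x ≤ 1 the profile involves `bulk` only at 1, 2 and 3, and 3 ≤ 2L keeps these within range of
`bulk_le_peak`. The allowance k + 2 serves the delayed profile of the second axis. -/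
lemma profile_le_peak (hκ : 0 ≤ κ) (hL : 3 / 2 ≤ L) {k l : ℕ} (hkl : l ≤ k + 2) {x : ℤ}
    (hx : x ≤ 1) : profile κ L l x ≤ peak κ L k := by
  have h3 := three_le_peak (L := L) hκ k
  have h : ∀ y : ℤ, 0 ≤ y → y ≤ 3 → bulk κ L (l / 4) y ≤ peak κ L k - 2 := fun y hy hy3 => by
    have : (y : ℝ) ≤ 3 := by exact_mod_cast hy3
    exact bulk_le_peak hκ (by omega) hy (by linarith)
  have h₁ := h 1 (by omega) (by omega)
  have h₂ := h 2 (by omega) (by omega)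
  have h₃ := h 3 (by omega) (by omega)
  rcases (show x < 0 ∨ x = 0 ∨ x = 1 by omega) with hx | rfl | rfl
  · rw [profile_of_neg l hx]; linarith
  · rw [profile]; simp only [lt_irrefl, if_false, if_true]
    split_ifs <;> linarith
  · rw [profile]; norm_num
    split_ifs <;> linarith

/-- The profile does not decrease under a zombie move, away from the axis. -/
lemma profile_zombie_of_pos {k : ℕ} (hk : k % 2 = 0) {x : ℤ} (hx : 0 < x) :
    1 / 2 * profile κ L k x + 1 / 2 * profile κ L k (x + 1) ≤ profile κ L (k + 1) x := by
  have h₁ : ¬ x < 0 := by omega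
  have h₂ : ¬ x + 1 < 0 := by omega
  have h₃ : x ≠ 0 := by omega
  have h₄ : x + 1 ≠ 0 := by omega
  have h₅ : (k + 1) / 4 = k / 4 := by omega
  rcases (show k % 4 = 0 ∨ k % 4 = 2 by omega) with h | h
  · have h' : (k + 1) % 4 = 1 := by omega
    simp only [profile, h, h', h₁, h₂, h₃, h₄, h₅, if_false, if_true]
    norm_num
  · have h' : (k + 1) % 4 = 3 := by omega
    simp only [profile, h, h', h₁, h₂, h₃, h₄, h₅, if_false, if_true]
    norm_num [add_assoc]
    linarith

/-- On the axis the zombie has a single move, along the axis, so all mass stays; half of the mass at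
1 and half of the unit mass at -1 join it. -/
lemma profile_zombie_zero {k : ℕ} (hk : k % 2 = 0) :
    profile κ L k 0 + 1 / 2 * profile κ L k 1 + 1 / 2 ≤ profile κ L (k + 1) 0 := by
  have h₅ : (k + 1) / 4 = k / 4 := by omega
  rcases (show k % 4 = 0 ∨ k % 4 = 2 by omega) with h | h
  · have h' : (k + 1) % 4 = 1 := by omega
    simp only [profile, h, h', h₅]
    norm_num
    linarith
  · have h' : (k + 1) % 4 = 3 := by omega
    simp only [profile, h, h', h₅]
    norm_num
    linarith

lemma profile_succ_of_mod_eq_one {k : ℕ} (hk : k % 4 = 1) (x : ℤ) :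
    profile κ L k x = profile κ L (k + 1) x := by
  have h₁ : (k + 1) % 4 = 2 := by omega
  have h₂ : (k + 1) / 4 = k / 4 := by omega
  simp [profile, hk, h₁, h₂]

/-- For x > 1 this is an identity: the second difference of the quadratic gives κ/2, the growth of
`bulk` per period. At x = 1 the axis mass re-enters the bulk, and the relation between κ and L is
exactly what makes the two sides equal. -/
lemma profile_shift {k : ℕ} (hk : k % 4 = 3) (hκ : 0 ≤ κ) (hκL : κ * (2 * L - 1) = 8) (x : ℤ) :
    profile κ L k (x - 1) ≤ profile κ L (k + 1) x := by
  have h₁ : (k + 1) % 4 = 0 := by omega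
  have h₂ : (k + 1) / 4 = k / 4 + 1 := by omega
  rcases (show x < 0 ∨ x = 0 ∨ x = 1 ∨ 1 < x by omega) with hx | rfl | rfl | hx
  · rw [profile_of_neg _ (by omega), profile_of_neg _ hx]
  · rw [profile_of_neg _ (by omega)]; exact one_le_profile hκ _ _
  · simp only [profile, hk, h₁, h₂, bulk]
    norm_num
    linarith
  · have h₃ : ¬ x - 1 < 0 := by omega
    have h₄ : ¬ x < 0 := by omega
    have h₅ : x - 1 ≠ 0 := by omega
    have h₆ : x ≠ 0 := by omega
    simp only [profile, hk, h₁, h₂, h₃, h₄, h₅, h₆, bulk]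
    norm_num
    apply le_of_eq
    ring

/-- The density of zombies that dominates the game. On the quarter plane behind the survivor it
matters only next to the survivor. -/
noncomputable def density (κ L : ℝ) (k : ℕ) (D : ℤ × ℤ) : ℝ :=
  if 0 ≤ D.1 ∧ 0 ≤ D.2 then
    if D.1 + D.2 = 0 then 4 * peak κ L k
    else if D.1 + D.2 = 1 ∧ k % 2 = 0 then peak κ L k else 0
  else if D.2 < 0 then profile κ L k D.1 else profile κ L (k + 2) D.2

lemma density_nonneg (hκ : 0 ≤ κ) (k : ℕ) (D : ℤ × ℤ) : 0 ≤ density κ L k D := by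
  have h := three_le_peak (L := L) hκ k
  have h₁ := one_le_profile (L := L) hκ k D.1
  have h₂ := one_le_profile (L := L) hκ (k + 2) D.2
  rw [density]
  split_ifs <;> linarith

lemma density_zero (k : ℕ) : density κ L k 0 = 4 * peak κ L k := by simp [density]

lemma density_of_snd_neg (k : ℕ) (x : ℤ) {y : ℤ} (hy : y < 0) :
    density κ L k (x, y) = profile κ L k x := by
  simp [density, hy, hy.not_ge]

lemma density_of_fst_neg (k : ℕ) {x : ℤ} (hx : x < 0) (y : ℤ) :
    density κ L k (x, y) = profile κ L (k + 2) y := by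
  by_cases hy : y < 0
  · rw [density_of_snd_neg _ _ hy, profile_of_neg _ hx, profile_of_neg _ hy]
  · simp [density, hx.not_ge, hy]

lemma one_le_density (hκ : 0 ≤ κ) (k : ℕ) {D : ℤ × ℤ}
    (hD : ¬ (0 ≤ D.1 ∧ 0 ≤ D.2 ∧ 2 ≤ D.1 + D.2 + (k % 2 : ℕ))) : 1 ≤ density κ L k D := by
  have h := three_le_peak (L := L) hκ k
  have h₁ := one_le_profile (L := L) hκ k D.1
  have h₂ := one_le_profile (L := L) hκ (k + 2) D.2
  rw [density]
  split_ifs <;> first | linarith | (exfalso; omega)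

/-- Away from the origin's neighbourhood this reduces to the one-dimensional profile inequalities,
since transport along an axis does not change a density constant in that direction. At the origin a
zombie move collects at most `peak` from each of four neighbours, hence the factor 4 in `density`.
-/
lemma push_density_le (hκ : 0 ≤ κ) (hL : 3 / 2 ≤ L) (hκL : κ * (2 * L - 1) = 8) (k : ℕ)
    (D : ℤ × ℤ) (hD : ¬ (0 ≤ D.1 ∧ 0 ≤ D.2 ∧ 2 ≤ D.1 + D.2 + ((k + 1) % 2 : ℕ))) :
    push k (density κ L k) D ≤ density κ L (k + 1) D := by
  obtain ⟨x, y⟩ := D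
  simp only at hD
  have hpk := peak_mono (L := L) hκ (Nat.le_succ k)
  have hp3 := three_le_peak (L := L) hκ k
  by_cases hk : k % 2 = 0
  · have hk' : ¬ (k + 1) % 2 = 0 := by omega
    have hk₂ : (k + 2) % 2 = 0 := by omega
    simp only [push, hk, if_true, sum_dirs, Prod.mk_sub_mk, sub_zero, sub_neg_eq_add]
    rcases lt_or_ge y 0 with hy | hy
    · have e : stepProb (0, -1) (x, y + 1) = 0 := by
        rw [stepProb, if_neg]; simp only; omega
      have ey : stepProb (0, 1) (x, y - 1) = if x = 0 then 1 else 1 / 2 := by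
        rw [stepProb, if_pos (by simp only; omega)]
        simp [show y - 1 ≠ 0 by omega]
      rw [density_of_snd_neg _ _ hy, density_of_snd_neg _ _ hy, density_of_snd_neg _ _ hy,
        density_of_snd_neg _ _ (show y - 1 < 0 by omega), e, ey]
      rcases lt_trichotomy x 0 with hx | rfl | hx
      · have e₁ : stepProb (-1, 0) (x + 1, y) = 0 := by
          rw [stepProb, if_neg]; simp only; omega
        have e₂ : stepProb (1, 0) (x - 1, y) = 1 / 2 := by
          rw [stepProb, if_pos (by simp only; omega), if_neg (by simp only; omega)]
        rw [e₁, e₂, if_neg hx.ne, profile_of_neg _ hx, profile_of_neg _ hx,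
          profile_of_neg _ (show x - 1 < 0 by omega)]
        norm_num
      · have e₁ : stepProb (-1, 0) (0 + 1, y) = 1 / 2 := by
          rw [stepProb, if_pos (by simp), if_neg (by simp only; omega)]
        have e₂ : stepProb (1, 0) (0 - 1, y) = 1 / 2 := by
          rw [stepProb, if_pos (by simp), if_neg (by simp only; omega)]
        have := profile_zombie_zero (κ := κ) (L := L) hk
        rw [e₁, e₂, if_pos rfl, profile_of_neg _ (show (0 : ℤ) - 1 < 0 by omega), zero_add]
        linarith
      · have e₁ : stepProb (-1, 0) (x + 1, y) = 1 / 2 := by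
          rw [stepProb, if_pos (by simp only; omega), if_neg (by simp only; omega)]
        have e₂ : stepProb (1, 0) (x - 1, y) = 0 := by
          rw [stepProb, if_neg]; simp only; omega
        have := profile_zombie_of_pos (κ := κ) (L := L) hk hx
        rw [e₁, e₂, if_neg hx.ne']
        linarith
    rcases lt_or_ge x 0 with hx | hx
    · have e : stepProb (-1, 0) (x + 1, y) = 0 := by
        rw [stepProb, if_neg]; simp only; omega
      have ex : stepProb (1, 0) (x - 1, y) = if y = 0 then 1 else 1 / 2 := by
        rw [stepProb, if_pos (by simp only; omega)]
        simp [show x - 1 ≠ 0 by omega]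
      rw [density_of_fst_neg _ hx, density_of_fst_neg _ hx, density_of_fst_neg _ hx,
        density_of_fst_neg _ (show x - 1 < 0 by omega), e, ex,
        show k + 1 + 2 = k + 2 + 1 by omega]
      have e₁ : stepProb (0, -1) (x, y + 1) = 1 / 2 := by
        rw [stepProb, if_pos (by simp only; omega), if_neg (by simp only; omega)]
      rw [e₁]
      rcases hy.eq_or_lt with rfl | hy
      · have e₂ : stepProb (0, 1) (x, 0 - 1) = 1 / 2 := by
          rw [stepProb, if_pos (by simp), if_neg (by simp only; omega)]
        have := profile_zombie_zero (κ := κ) (L := L) hk₂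
        rw [e₂, if_pos rfl, profile_of_neg _ (show (0 : ℤ) - 1 < 0 by omega), zero_add]
        linarith
      · have e₂ : stepProb (0, 1) (x, y - 1) = 0 := by
          rw [stepProb, if_neg]; simp only; omega
        have := profile_zombie_of_pos (κ := κ) (L := L) hk₂ hy
        rw [e₂, if_neg hy.ne']
        linarith
    · obtain rfl : x = 0 := by omega
      obtain rfl : y = 0 := by omega
      have h₁ := profile_le_peak hκ hL (show k ≤ k + 2 by omega) (show (0 : ℤ) ≤ 1 by omega)
      have h₂ := profile_le_peak hκ hL (le_refl (k + 2)) (show (0 : ℤ) ≤ 1 by omega)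
      rw [density_of_fst_neg _ (show (0 : ℤ) - 1 < 0 by omega),
        density_of_snd_neg _ _ (show (0 : ℤ) - 1 < 0 by omega)]
      simp [stepProb, density, hk]
      linarith
  · have hk' : (k + 1) % 2 = 0 := by omega
    have hcases : shift k = (0, 1) ∧ k % 4 = 1 ∨ shift k = (1, 0) ∧ k % 4 = 3 := by
      simp only [shift]; split_ifs <;> simp <;> omega
    simp only [push, hk, if_false]
    rcases hcases with ⟨hs, hk4⟩ | ⟨hs, hk4⟩
    · rw [hs]
      split_ifs with h0
      · exact density_nonneg hκ _ _
      simp only [Prod.mk_sub_mk, sub_zero]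
      rcases lt_or_ge y 0 with hy | hy
      · rw [density_of_snd_neg _ _ hy, density_of_snd_neg _ _ (by omega),
          profile_succ_of_mod_eq_one hk4]
      rcases lt_or_ge x 0 with hx | hx
      · rw [density_of_fst_neg _ hx, density_of_fst_neg _ hx]
        exact profile_shift (k := k + 2) (by omega) hκ hκL y
      -- The only other point left is (0, 1), which would receive mass from the origin, where it has
      -- been absorbed.
      · obtain rfl : y = 0 := by
          by_contra hne
          exact h0 (by rw [Prod.mk.injEq]; omega)
        have := profile_le_peak hκ hL (show k ≤ k + 1 + 2 by omega) (show x ≤ 1 by omega)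
        rw [density_of_snd_neg _ _ (by omega)]
        have hp3' := three_le_peak (L := L) hκ (k + 1)
        rcases (show x = 0 ∨ x = 1 by omega) with rfl | rfl <;> simp [density, hk'] <;> linarith
    · rw [hs]
      split_ifs with h0
      · exact density_nonneg hκ _ _
      simp only [Prod.mk_sub_mk, sub_zero]
      rcases lt_or_ge y 0 with hy | hy
      · rw [density_of_snd_neg _ _ hy, density_of_snd_neg _ _ hy]
        exact profile_shift hk4 hκ hκL x
      rcases lt_or_ge x 0 with hx | hx
      · rw [density_of_fst_neg _ hx, density_of_fst_neg _ (by omega),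
          profile_succ_of_mod_eq_one (k := k + 2) (by omega)]
      · obtain rfl : x = 0 := by
          by_contra hne
          exact h0 (by rw [Prod.mk.injEq]; omega)
        have := profile_le_peak hκ hL (show k + 2 ≤ k + 1 + 2 by omega) (show y ≤ 1 by omega)
        rw [density_of_fst_neg _ (by omega)]
        have hp3' := three_le_peak (L := L) hκ (k + 1)
        rcases (show y = 0 ∨ y = 1 by omega) with rfl | rfl <;> simp [density, hk'] <;> linarith

end

/-! ### The game on the torus in relative coordinates -/

lemma zombieAvg_congr {h h' : ℤ × ℤ → ENNReal} {D : ℤ × ℤ}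
    (H : ∀ v ∈ dirs, v.1 * D.1 + v.2 * D.2 < 0 → h (D + v) = h' (D + v)) :
    zombieAvg h D = zombieAvg h' D := by
  refine Finset.sum_congr rfl fun v hv => ?_
  by_cases hneg : v.1 * D.1 + v.2 * D.2 < 0
  · rw [H v hv hneg]
  · simp [stepProb, hneg]

/-- A position from which the game of `r` more rounds does not leave the square of radius `K`. -/
def Within (K : ℤ) (r : ℕ) (D : ℤ × ℤ) : Prop :=
  r ≤ K ∧ -K ≤ D.1 ∧ D.1 + r ≤ K ∧ -K ≤ D.2 ∧ D.2 + r ≤ K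

lemma Within.two_mul_lt {n : ℕ} {K : ℤ} (hK : 2 * (K + 1) < n) {r : ℕ} {D : ℤ × ℤ}
    (h : Within K r D) : 2 * (|D.1| + 1) < n ∧ 2 * (|D.2| + 1) < n := by
  obtain ⟨h₁, h₂, h₃, h₄, h₅⟩ := h
  have h₁ := abs_le.2 ⟨h₂, (by omega : D.1 ≤ K)⟩
  have h₂ := abs_le.2 ⟨h₄, (by omega : D.2 ≤ K)⟩
  omega

/-- A zombie move can increase a coordinate only if it is negative, and then to at most 0; this is
where r ≤ K is needed. -/
lemma Within.zombie {K : ℤ} {r : ℕ} {D v : ℤ × ℤ} (h : Within K r D) (hv : v ∈ dirs)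
    (hneg : v.1 * D.1 + v.2 * D.2 < 0) : Within K r (D + v) := by
  obtain ⟨h₁, h₂, h₃, h₄, h₅⟩ := h
  simp only [dirs, Finset.mem_insert, Finset.mem_singleton] at hv
  rcases hv with rfl | rfl | rfl | rfl <;> simp only at hneg <;>
    refine ⟨h₁, ?_, ?_, ?_, ?_⟩ <;> simp only [Prod.fst_add, Prod.snd_add] <;> omega

lemma Within.survivor {K : ℤ} {r : ℕ} {D : ℤ × ℤ} (h : Within K (r + 1) D) (k : ℕ) :
    Within K r (D + shift k) := by
  obtain ⟨h₁, h₂, h₃, h₄, h₅⟩ := h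
  push_cast at *
  rw [shift, Within, Prod.fst_add, Prod.snd_add]
  split_ifs <;> dsimp only <;> omega

lemma add_red_eq_iff {n : ℕ} {K : ℤ} (hK : 2 * (K + 1) < n) {r : ℕ} {D : ℤ × ℤ}
    (h : Within K r D) (s : Vertex n) : s + red n D = s ↔ D = 0 := by
  obtain ⟨h₁, h₂⟩ := h.two_mul_lt hK
  have h₀ : 2 * |(0 : ℤ)| < n := by simp; have := abs_nonneg D.1; omega
  rw [add_eq_left, ← red_zero, red_injOn (by omega) (by omega) h₀ h₀]

/-- The last `r` moves of the diagonal strategy, the first of which has number `j`. -/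
def diagonalMoves : ℕ → ℕ → List Move
  | 0, _ => []
  | r + 1, j => (if j % 2 = 0 then .south else .west) :: diagonalMoves r (j + 1)

lemma ofFn_eq_diagonalMoves (r j : ℕ) :
    List.ofFn (fun i : Fin r => if (j + i) % 2 = 0 then Move.south else Move.west) =
      diagonalMoves r j := by
  induction r generalizing j with
  | zero => simp [diagonalMoves]
  | succ r ih =>
    rw [List.ofFn_succ, diagonalMoves, ← ih]
    simp only [Fin.val_zero, add_zero, Fin.val_succ, add_assoc, add_comm 1]

lemma vec_diagonal (n j : ℕ) : (if j % 2 = 0 then Move.south else Move.west).vec n =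
    red n (-shift (2 * j + 1)) := by
  by_cases h : j % 2 = 0
  · simp [h, shift, show (2 * j + 1) % 4 = 1 by omega, red, Move.vec]
  · simp [h, shift, show ¬ (2 * j + 1) % 4 = 1 by omega, red, Move.vec]

lemma play_self (τ : MovesFirst) (n : ℕ) (l : List Move) (s : Vertex n) :
    play τ n l s s = PMF.pure true := by
  cases l <;> simp [play]

lemma zombieStep_self (n : ℕ) (s : Vertex n) : zombieStep n s s = PMF.pure s := by
  rw [zombieStep, dif_neg]
  rintro ⟨-, w, hw⟩
  simp [closer] at hw

lemma play_zombies_cons {n : ℕ} (m : Move) (l : List Move) {s z : Vertex n} (h : z ≠ s) :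
    play .zombies n (m :: l) s z = (zombieStep n s z).bind fun w =>
      if w = s then PMF.pure true else play .zombies n l (s + m.vec n) w := by
  rw [play, if_neg h]

lemma play_survivor_cons {n : ℕ} (m : Move) (l : List Move) {s z : Vertex n} (h : z ≠ s) :
    play .survivor n (m :: l) s z =
      (zombieStep n (s + m.vec n) z).bind fun w => play .survivor n l (s + m.vec n) w := by
  rw [play, if_neg h]

/-- The number of the half-step with which the game begins. -/
def MovesFirst.offset : MovesFirst → ℕ
  | .zombies => 0
  | .survivor => 1

lemma play_diagonalMoves (τ : MovesFirst) {n : ℕ} {K : ℤ} (hK : 2 * (K + 1) < n) (r : ℕ) :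
    ∀ (j : ℕ) (s : Vertex n) (D : ℤ × ℤ), Within K r D →
      play τ n (diagonalMoves r j) s (s + red n D) true =
        hit (2 * r) (τ.offset + 2 * j) D := by
  induction r with
  | zero =>
    intro j s D h
    by_cases hD : D = 0 <;> simp [diagonalMoves, play, hit, add_red_eq_iff hK h, hD]
  | succ r ih =>
    intro j s D h
    rw [show 2 * (r + 1) = (2 * r + 1) + 1 by ring]
    by_cases hD : D = 0
    · subst hD; simp [play_self, hit_zero_right]
    have h' : ∀ E : ℤ × ℤ, s + red n E = s + red n (-shift (2 * j + 1)) +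
        red n (E + shift (2 * j + 1)) := fun E => by
      rw [add_assoc, ← red_add]; congr 2; abel
    have hne : s + red n D ≠ s := by rwa [Ne, add_red_eq_iff hK h]
    obtain ⟨b₁, b₂⟩ := h.two_mul_lt hK
    rw [diagonalMoves]
    cases τ with
    | zombies =>
      rw [play_zombies_cons _ _ hne, vec_diagonal, zombieStep_bind_apply s b₁ b₂ hD,
        show MovesFirst.zombies.offset + 2 * j = 2 * j from zero_add _, hit, if_neg hD,
        if_pos (by omega)]
      refine zombieAvg_congr fun v hv hneg => ?_
      have hE := h.zombie hv hneg
      rw [hit, if_neg (by omega : ¬ (2 * j + 1) % 2 = 0)]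
      simp only [add_red_eq_iff hK hE]
      split_ifs with h0
      · simp
      · have := ih (j + 1) (s + red n (-shift (2 * j + 1))) _ (hE.survivor (2 * j + 1))
        rw [← h'] at this
        rw [this, show MovesFirst.zombies.offset + 2 * (j + 1) = 2 * j + 1 + 1 from zero_add _]
    | survivor =>
      rw [play_survivor_cons _ _ hne, vec_diagonal, h' D,
        show MovesFirst.survivor.offset + 2 * j = 2 * j + 1 from add_comm _ _, hit, if_neg hD,
        if_neg (by omega), hit]
      have hE := h.survivor (2 * j + 1)
      -- If the survivor steps onto the zombie, `play` tests this only after her move; she stays,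
      -- having no closer neighbour, so he is still eaten.
      by_cases h0 : D + shift (2 * j + 1) = 0
      · rw [h0, red_zero, add_zero]; simp [zombieStep_self, play_self]
      · obtain ⟨b₁, b₂⟩ := hE.two_mul_lt hK
        rw [zombieStep_bind_apply _ b₁ b₂ h0, if_neg h0, if_pos (by omega)]
        refine zombieAvg_congr fun v hv hneg => ?_
        rw [ih (j + 1) _ _ (hE.zombie hv hneg)]
        rw [show MovesFirst.survivor.offset + 2 * (j + 1) = 2 * j + 1 + 1 + 1 from add_comm _ _]

/-! ### Endpoints of the diagonal walk -/

lemma sum_vec_diagonal (n r : ℕ) :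
    ∑ i ∈ Finset.range r, (if i % 2 = 0 then Move.south else Move.west).vec n =
      red n (-((r / 2 : ℕ) : ℤ), -(((r + 1) / 2 : ℕ) : ℤ)) := by
  induction r with
  | zero => exact (red_zero n).symm
  | succ r ih =>
    rw [Finset.sum_range_succ, ih, vec_diagonal, ← red_add]
    congr 1
    rw [shift]
    split_ifs <;> ext <;> simp <;> omega

lemma diagonal_start (n : ℕ) : (diagonal n).start =
    red n (((rounds n / 2 : ℕ) : ℤ), (((rounds n + 1) / 2 : ℕ) : ℤ)) := by
  simp only [diagonal, red, Int.cast_natCast]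

lemma diagonal_final (n : ℕ) : (diagonal n).final = 0 := by
  rw [Strategy.final, diagonal_start]
  have := sum_vec_diagonal n (rounds n)
  rw [← Fin.sum_univ_eq_sum_range
    (fun i => (if i % 2 = 0 then Move.south else Move.west).vec n)] at this
  rw [show ∑ i, ((diagonal n).move i).vec n = _ from this, ← red_add, ← red_zero]
  congr 1
  ext <;> simp

lemma play_diagonal (τ : MovesFirst) {n : ℕ} (hn : 13 ≤ n) {q : ℤ × ℤ}
    (hq : q ∈ Finset.Icc (-(rounds n : ℤ)) (rounds n) ×ˢ
      Finset.Icc (-(rounds n : ℤ)) (rounds n)) :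
    play τ n (List.ofFn (diagonal n).move) (diagonal n).start
      ((diagonal n).final + ((q.1 : ZMod n), (q.2 : ZMod n))) true =
    hit (2 * rounds n) τ.offset
      (q - (((rounds n / 2 : ℕ) : ℤ), (((rounds n + 1) / 2 : ℕ) : ℤ))) := by
  set c : ℤ × ℤ := (((rounds n / 2 : ℕ) : ℤ), (((rounds n + 1) / 2 : ℕ) : ℤ)) with hc
  have h₁ : (diagonal n).final + ((q.1 : ZMod n), (q.2 : ZMod n)) =
      (diagonal n).start + red n (q - c) := by
    rw [diagonal_final, diagonal_start, ← hc, ← red_add]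
    simp [red]
  have h₂ : List.ofFn (diagonal n).move = diagonalMoves (rounds n) 0 := by
    rw [← ofFn_eq_diagonalMoves]; simp [diagonal]
  have hM : rounds n = n / 4 := rfl
  simp only [Finset.mem_product, Finset.mem_Icc] at hq
  -- The relative coordinates start between -K and K - M for K = M + ⌈M/2⌉. The bound 2(K + 1) < n
  -- fails at n = 12 and holds from n = 13 on.
  rw [h₁, h₂, play_diagonalMoves τ (K := rounds n + ((rounds n + 1) / 2 : ℕ)) (by omega)]
  · rfl
  · rw [Within, Prod.fst_sub, Prod.snd_sub, hc]
    dsimp only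
    omega

/-! ### Bounds on the total weight -/

lemma weight_eq_sum (τ : MovesFirst) {n : ℕ} (S : Strategy n) :
    weight τ S = (∑ q ∈ Finset.Icc (-(rounds n : ℤ)) (rounds n) ×ˢ
      Finset.Icc (-(rounds n : ℤ)) (rounds n), play τ n (List.ofFn S.move) S.start
        (S.final + ((q.1 : ZMod n), (q.2 : ZMod n))) true).toReal := by
  rw [ENNReal.toReal_sum fun _ _ => PMF.apply_ne_top _ _, Finset.sum_product]
  rfl

lemma tsum_hit_le {κ L : ℝ} (hL : 3 / 2 ≤ L) (hκL : κ * (2 * L - 1) = 8) (r k : ℕ) :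
    ∑' D, hit r k D ≤ ENNReal.ofReal ((r + 1) * (4 * peak κ L (k + r))) := by
  have hκ : 0 ≤ κ := by
    by_contra! h
    nlinarith
  calc ∑' D, hit r k D ≤ ∑' D, ENNReal.ofReal (density κ L k D) * hit r k D := by
        refine ENNReal.tsum_le_tsum fun D => ?_
        by_cases hD : 0 ≤ D.1 ∧ 0 ≤ D.2 ∧ 2 ≤ D.1 + D.2 + (k % 2 : ℕ)
        · rw [hit_eq_zero r k D hD.1 hD.2.1 hD.2.2]; simp
        · have := one_le_density (L := L) hκ k hD
          calc hit r k D = ENNReal.ofReal 1 * hit r k D := by simp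
            _ ≤ _ := by gcongr
    _ ≤ ∑ j ∈ Finset.range (r + 1), ENNReal.ofReal (density κ L (k + j) 0) :=
        tsum_mul_hit_le (density_nonneg hκ) (push_density_le hκ hL hκL) r k
    _ ≤ ∑ j ∈ Finset.range (r + 1), ENNReal.ofReal (4 * peak κ L (k + r)) := by
        refine Finset.sum_le_sum fun j hj => ?_
        rw [density_zero]
        have := peak_mono (L := L) hκ (show k + j ≤ k + r by have := Finset.mem_range.1 hj; omega)
        gcongr
    _ = _ := by
        rw [Finset.sum_const, Finset.card_range, nsmul_eq_mul,
          ENNReal.ofReal_mul (by positivity : (0 : ℝ) ≤ r + 1), ← Nat.cast_succ,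
          ENNReal.ofReal_natCast]

lemma weight_diagonal_le (τ : MovesFirst) {n : ℕ} (hn : 13 ≤ n) :
    weight τ (diagonal n) ≤ 76 * (n : ℝ) ^ (3 / 2 : ℝ) := by
  have hn' : (13 : ℝ) ≤ n := by exact_mod_cast hn
  -- As κ is of order 1/L, the peak is of order t/L + L with t of order n; L = √n balances the
  -- terms.
  set L := √(n : ℝ) with hLdef
  have hL2 : L ^ 2 = n := Real.sq_sqrt (by positivity)
  have hL : 3 ≤ L := Real.le_sqrt_of_sq_le (by linarith)
  have hpow : (n : ℝ) ^ (3 / 2 : ℝ) = n * L := by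
    rw [show (3 / 2 : ℝ) = 1 + 1 / 2 by norm_num, Real.rpow_add (by positivity), Real.rpow_one,
      ← Real.sqrt_eq_rpow]
  set κ := 8 / (2 * L - 1) with hκdef
  have hκL : κ * (2 * L - 1) = 8 := div_mul_cancel₀ _ (by linarith)
  have hκ : κ * L ≤ 8 := by
    rw [hκdef, div_mul_eq_mul_div, div_le_iff₀ (by linarith)]
    linarith
  have hκ0 : 0 ≤ κ := by rw [hκdef]; exact div_nonneg (by norm_num) (by linarith)
  have hoff : τ.offset ≤ 1 := by cases τ <;> simp [MovesFirst.offset]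
  have hM : (4 : ℝ) * rounds n ≤ n := by
    exact_mod_cast (show 4 * (n / 4) ≤ n by omega)
  have hpeak : peak κ L (τ.offset + 2 * rounds n) ≤ 19 * L := by
    have h₁ := peak_mono (L := L) hκ0 (show τ.offset + 2 * rounds n ≤ 1 + 2 * rounds n by omega)
    refine h₁.trans ?_
    rw [peak]
    push_cast
    -- With κL ≤ 8 this gives a peak of at most 3 + 16L ≤ 19L, and 76 = 4 · 19.
    have : κ * ((1 + 2 * rounds n + 2) / 8 + L ^ 2) ≤ κ * (2 * L ^ 2) :=
      mul_le_mul_of_nonneg_left (by rw [hL2]; linarith) hκ0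
    nlinarith
  have hsum : ∑ q ∈ Finset.Icc (-(rounds n : ℤ)) (rounds n) ×ˢ
      Finset.Icc (-(rounds n : ℤ)) (rounds n), play τ n (List.ofFn (diagonal n).move)
        (diagonal n).start ((diagonal n).final + ((q.1 : ZMod n), (q.2 : ZMod n))) true ≤
      ENNReal.ofReal (76 * (n * L)) := by
    rw [Finset.sum_congr rfl fun q hq => play_diagonal τ hn hq]
    -- Enlarging the window to all of ℤ² makes the sum translation invariant, so the starting vertex
    -- drops out.
    refine (ENNReal.sum_le_tsum _).trans ?_
    refine ((Equiv.subRight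
      (((rounds n / 2 : ℕ) : ℤ), (((rounds n + 1) / 2 : ℕ) : ℤ))).tsum_eq
      (fun D => hit (2 * rounds n) τ.offset D)).le.trans ?_
    refine (tsum_hit_le (by linarith) hκL _ _).trans (ENNReal.ofReal_le_ofReal ?_)
    push_cast
    calc (2 * (rounds n : ℝ) + 1) * (4 * peak κ L (τ.offset + 2 * rounds n))
        ≤ n * (4 * (19 * L)) := by
          have := three_le_peak (L := L) hκ0 (τ.offset + 2 * rounds n)
          gcongr
          linarith
      _ = _ := by ring
  rw [weight_eq_sum, hpow]
  exact ENNReal.toReal_le_of_le_ofReal (by positivity) hsum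

/-! ### Lower bound on the weight of every strategy -/

lemma red_sum (n : ℕ) {ι : Type*} (t : Finset ι) (f : ι → ℤ × ℤ) :
    red n (∑ i ∈ t, f i) = ∑ i ∈ t, red n (f i) := by
  classical
  induction t using Finset.induction_on with
  | empty => simp
  | insert a t ha ih => rw [Finset.sum_insert ha, Finset.sum_insert ha, red_add, ih]

lemma exists_vec_eq_red (n : ℕ) (m : Move) :
    ∃ E : ℤ × ℤ, m.vec n = red n E ∧ |E.1| ≤ 1 ∧ |E.2| ≤ 1 := by
  cases m
  · exact ⟨(-1, 0), by simp [Move.vec, red], by simp, by simp⟩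
  · exact ⟨(1, 0), by simp [Move.vec, red], by simp, by simp⟩
  · exact ⟨(0, 1), by simp [Move.vec, red], by simp, by simp⟩
  · exact ⟨(0, -1), by simp [Move.vec, red], by simp, by simp⟩
  · exact ⟨(0, 0), by simp [Move.vec, red], by simp, by simp⟩

lemma eatProb_nonneg (τ : MovesFirst) {n : ℕ} (S : Strategy n) (x y : ℤ) : 0 ≤ eatProb τ S x y :=
  ENNReal.toReal_nonneg

/-- The zombie that starts at the first vertex of the survivor eats him. -/
lemma one_le_weight (τ : MovesFirst) {n : ℕ} (S : Strategy n) : 1 ≤ weight τ S := by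
  choose E hE hE₁ hE₂ using fun i => exists_vec_eq_red n (S.move i)
  have habs : ∀ f : Fin (rounds n) → ℤ, (∀ i, |f i| ≤ 1) →
      -(∑ i, f i) ∈ Finset.Icc (-(rounds n : ℤ)) (rounds n) := fun f hf => by
    have h := (Finset.abs_sum_le_sum_abs f Finset.univ).trans
      (Finset.sum_le_card_nsmul _ _ 1 fun i _ => hf i)
    simp only [Finset.card_univ, Fintype.card_fin, nsmul_eq_mul, mul_one] at h
    have := abs_le.1 h
    rw [Finset.mem_Icc]
    omega
  have h₁ := habs _ hE₁
  have h₂ := habs _ hE₂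
  set x := -∑ i, (E i).1 with hx
  set y := -∑ i, (E i).2 with hy
  have hstart : S.final + ((x : ZMod n), (y : ZMod n)) = S.start := by
    have : ((x : ZMod n), (y : ZMod n)) = red n (-∑ i, E i) := by
      simp [red, hx, hy, Prod.fst_sum, Prod.snd_sum]
    rw [this, Strategy.final, Finset.sum_congr rfl fun i _ => hE i, ← red_sum, add_assoc,
      ← red_add]
    simp
  have heat : eatProb τ S x y = 1 := by
    rw [eatProb, hstart, play_self]
    simp
  rw [← heat, weight]
  exact (Finset.single_le_sum (f := fun y => eatProb τ S x y)
    (fun _ _ => eatProb_nonneg τ S _ _) h₂).trans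
    (Finset.single_le_sum (f := fun x => ∑ y ∈ Finset.Icc (-(rounds n : ℤ)) (rounds n),
      eatProb τ S x y) (fun _ _ => Finset.sum_nonneg fun _ _ => eatProb_nonneg τ S _ _) h₁)

lemma one_le_minWeight (τ : MovesFirst) (n : ℕ) : 1 ≤ minWeight τ n :=
  have : Nonempty (Strategy n) := ⟨diagonal n⟩
  le_ciInf fun S => one_le_weight τ S

lemma minWeight_le (τ : MovesFirst) {n : ℕ} (S : Strategy n) : minWeight τ n ≤ weight τ S :=
  ciInf_le ⟨1, by rintro _ ⟨S, rfl⟩; exact one_le_weight τ S⟩ S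

end ZombieTorus

theorem theorem2p3 (τ : ZombieTorus.MovesFirst) :
    ((fun n : ℕ => ZombieTorus.weight τ (ZombieTorus.diagonal n))
      =O[atTop] fun n : ℕ => (n : ℝ) ^ (3 / 2 : ℝ)) ∧
    ((fun n : ℕ => ZombieTorus.minWeight τ n)
      =O[atTop] fun n : ℕ => (n : ℝ) ^ (3 / 2 : ℝ)) ∧
    (∀ᶠ n : ℕ in atTop, 0 < ZombieTorus.minWeight τ n) ∧
    ((fun n : ℕ => (n : ℝ) ^ (3 / 2 : ℝ))
      =O[atTop] fun n : ℕ => (n : ℝ) ^ 3 / ZombieTorus.minWeight τ n) := by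
  have hmin : ∀ n, 13 ≤ n → ZombieTorus.minWeight τ n ≤ 76 * (n : ℝ) ^ (3 / 2 : ℝ) := fun n hn =>
    (ZombieTorus.minWeight_le τ _).trans (ZombieTorus.weight_diagonal_le τ hn)
  have hpos : ∀ n, 0 < ZombieTorus.minWeight τ n := fun n =>
    zero_lt_one.trans_le (ZombieTorus.one_le_minWeight τ n)
  refine ⟨.of_bound 76 ?_, .of_bound 76 ?_, .of_forall hpos, .of_bound 76 ?_⟩ <;>
    filter_upwards [eventually_ge_atTop 13] with n hn
  · rw [Real.norm_of_nonneg (zero_le_one.trans (ZombieTorus.one_le_weight τ _)),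
      Real.norm_of_nonneg (by positivity)]
    exact ZombieTorus.weight_diagonal_le τ hn
  · rw [Real.norm_of_nonneg (hpos n).le, Real.norm_of_nonneg (by positivity)]
    exact hmin n hn
  · have hcube : (n : ℝ) ^ 3 = (n : ℝ) ^ (3 / 2 : ℝ) * (n : ℝ) ^ (3 / 2 : ℝ) := by
      rw [← Real.rpow_add (by positivity), ← Real.rpow_natCast]
      norm_num
    have hp := hpos n
    rw [Real.norm_of_nonneg (by positivity), Real.norm_of_nonneg (by positivity), hcube,
      ← mul_div_assoc, le_div_iff₀ hp]
    have := mul_le_mul_of_nonneg_left (hmin n hn)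
      (show 0 ≤ (n : ℝ) ^ (3 / 2 : ℝ) by positivity)
    linarith
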